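/- Fix integers $1\le r\le K$. For $n$ divisible by $K$, let $\mathcal G=([n],\mathcal E)$ be an Erdős–Rényi graph $\mathrm{ER}(n,p)$, $p=p_n\in(0,1]$: each unordered pair of vertices is an edge with probability $p$, independently of the others (the statement holds both if self-loops $\{i,i\}$ are among these pairs and if they are excluded). For every ordered pair $(i,j)$ with $\{i,j\}\in\mathcal E$ there is an intermediate value $v_{i,j}\in\{0,1\}^T$, where $T=T_n\ge 1$. An allocation of computation load $r$ to $K$ machines is $A=(\mathcal M,\mathcal R)$, where $\mathcal M_1,\dots,\mathcal M_K\subseteq[n]$ cover $[n]$ with $|\mathcal M_k|=rn/K$ for all $k$, and $\mathcal R_1,\dots,\mathcal R_K$ partition $[n]$ with $|\mathcal R_k|=n/K$ for all $k$; let $\mathcal A(r)$ be the set of these allocations. Given $A$ and a realization $G$ of the graph, a feasible shuffle scheme consists of messages $X_k\in\{0,1\}^{c_k}$, $k\in[K]$, where $X_k$ is a function of the values $v_{i,j}$ with $j\in\mathcal M_k$, such that, for all possible intermediate values, each machine $k$ can recover all $v_{i,j}$ with $i\in\mathcal R_k$, $j\notin\mathcal M_k$ from the values $v_{i,j}$ with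 $j\in\mathcal M_k$ and the messages $X_{k'}$, $k'\ne k$. Let $L_A(r,G)$ be the minimum of $\frac{1}{n^2T}\sum_{k=1}^K c_k$ over all feasible shuffle schemes, and let $$L^*(r)=\inf_{A\in\mathcal A(r)}\mathbb E_{\mathcal G}\big[L_A(r,\mathcal G)\big].$$ If $p=\omega(1/n^2)$, that is, $n^2p_n\to\infty$, then, as $n\to\infty$ through the multiples of $K$, $$\lim_{n\to\infty}\frac{L^*(r)}{p}=\frac1r\Big(1-\frac rK\Big).$$ The same holds if in the definition of $\mathcal A(r)$ the condition $|\mathcal M_k|=rn/K$ for all $k$ is weakened to $\sum_{k=1}^K|\mathcal M_k|=rn$. -/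

import Mathlib

open Filter Topology MeasureTheory ProbabilityTheory

/-- Binary strings of length `T`. -/
abbrev Word (T : ℕ) : Type := Fin T → ZMod 2

/-- The unordered pairs of vertices that may be edges: all pairs of distinct vertices and,
if `loops` holds, also the self-loops. -/
def potentialEdges (loops : Prop) (n : ℕ) : Set (Sym2 (Fin n)) :=
  {e | loops ∨ ¬ e.IsDiag}

/-- The Erdős–Rényi law on undirected graphs on `Fin n` (given by their edge sets): every
potential edge is present with probability `p`, independently of the others. -/
noncomputable def erdosRenyi (loops : Prop) (n : ℕ) (p : unitInterval) :
    Measure (Set (Sym2 (Fin n))) :=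
  setBernoulli (potentialEdges loops n) p

/-- The sets `M k` of vertices mapped by, and `R k` of vertices reduced by, each machine `k`. -/
structure Allocation (K n : ℕ) where
  /-- vertices whose files are stored and mapped by each machine -/
  M : Fin K → Finset (Fin n)
  /-- vertices whose Reduce computations are assigned to each machine -/
  R : Fin K → Finset (Fin n)

/-- Allocations of computation load `r`: every vertex is mapped by some machine,
`∑ₖ |Mₖ| = r n`, and the `Rₖ` partition the vertices into `K` parts of equal size `n / K`. -/
def allocations (K n r : ℕ) : Set (Allocation K n) :=
  {A | (∀ i, ∃ k, i ∈ A.M k) ∧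
    ∑ k, (A.M k).card = r * n ∧
    (∀ i, ∃ k, i ∈ A.R k) ∧
    (∀ k l, k ≠ l → Disjoint (A.R k) (A.R l)) ∧
    ∀ k, K * (A.R k).card = n}

/-- The allocations of load `r` in which every machine maps the same number `r n / K` of
vertices. -/
def balancedAllocations (K n r : ℕ) : Set (Allocation K n) :=
  {A | A ∈ allocations K n r ∧ ∀ k, K * (A.M k).card = r * n}

/-- Indices `(i, j)` of the intermediate values `v_{i,j}`: there is one for every ordered pair
such that `j` is a neighbour of `i` in the graph with edge set `E`. -/
abbrev ValueIdx {n : ℕ} (E : Set (Sym2 (Fin n))) : Type :=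
  {e : Fin n × Fin n // s(e.1, e.2) ∈ E}

/-- Indices `(i, j)` of the intermediate values that machine `k` computes in the Map phase. -/
abbrev LocalIdx {K n : ℕ} (A : Allocation K n) (E : Set (Sym2 (Fin n))) (k : Fin K) : Type :=
  {e : ValueIdx E // e.1.2 ∈ A.M k}

/-- Indices `(i, j)` of the intermediate values that machine `k` needs for its Reduce
computations but does not compute itself. -/
abbrev NeededIdx {K n : ℕ} (A : Allocation K n) (E : Set (Sym2 (Fin n))) (k : Fin K) : Type :=
  {e : ValueIdx E // e.1.1 ∈ A.R k ∧ e.1.2 ∉ A.M k}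

/-- A feasible Shuffle coding scheme for the allocation `A` on the graph with edge set `E`, with
intermediate values of `T` bits. Machine `k` multicasts a message of `c k` bits computed from its
local intermediate values; from the messages of the other machines and its own local values every
machine recovers all the values it needs, whatever the intermediate values are. -/
structure ShuffleScheme {K n : ℕ} (A : Allocation K n) (E : Set (Sym2 (Fin n))) (T : ℕ) where
  /-- message lengths in bits -/
  c : Fin K → ℕ
  /-- the message of machine `k` -/
  encode : ∀ k, (LocalIdx A E k → Word T) → Word (c k)
  /-- recovery at machine `k` -/
  decode : ∀ k, (LocalIdx A E k → Word T) → (∀ l : {l : Fin K // l ≠ k}, Word (c l.1)) →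
    NeededIdx A E k → Word T
  correct : ∀ (v : ValueIdx E → Word T) (k : Fin K) (e : NeededIdx A E k),
    decode k (fun d => v d.1) (fun l => encode l.1 (fun d => v d.1)) e = v e.1

/-- The normalized communication load `(∑ₖ cₖ) / (n² T)` of a Shuffle scheme. -/
noncomputable def ShuffleScheme.load {K n : ℕ} {A : Allocation K n} {E : Set (Sym2 (Fin n))}
    {T : ℕ} (S : ShuffleScheme A E T) : ℝ :=
  ((∑ k, S.c k : ℕ) : ℝ) / ((n : ℝ) ^ 2 * (T : ℝ))

/-- `L_A(r, G)`: the minimum normalized load over all feasible Shuffle schemes. -/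
noncomputable def minLoad {K n : ℕ} (A : Allocation K n) (T : ℕ) (E : Set (Sym2 (Fin n))) : ℝ :=
  ⨅ S : ShuffleScheme A E T, S.load

/-- The infimum, over the allocations in `𝒜`, of the average over the Erdős–Rényi graph of the
minimum normalized load. With `𝒜` the allocations of load `r` this is `L*(r)`. -/
noncomputable def minAvgLoad {K n : ℕ} (𝒜 : Set (Allocation K n)) (T : ℕ) (loops : Prop)
    (p : unitInterval) : ℝ :=
  ⨅ A : 𝒜, ∫ E, minLoad A.1 T E ∂(erdosRenyi loops n p)

/-! ### Edge counts in the Erdős–Rényi graph: means and deviations -/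

section Probability

open unitInterval

/-! A needed value whose vertex is mapped by u machines costs 1/u of its T bits; both bounds rest on
this.

Converse. On a fixed graph, an induction over sets of machines that counts message tuples instead of
using entropy shows that every scheme sends at least T times the sum of 1/u over the needed values
(`converseWeight_mul_log_le`). In expectation each off-diagonal pair carries a factor p. As the u
average r and 1/u is convex, the weights sum to at least n²(1/r - 1/K) (`sum_pairWeight_ge`). The
diagonal accounts for at most np, so loops do not matter.

Achievability. Map each vertex at exactly r machines, using the r-sets almost equally often
(`exists_balanced_assignment`). In a group S of r + 1 machines, the bits needed by k and mapped
exactly by S \ {k} are spread over the r other members; a sender transmits sums mod 2 with at most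
one bit per receiver, and each receiver knows all the other summands (`exists_shuffleScheme`). A
group thus costs (r+1)/r times its largest demand, up to rounding. Demands have mean at most about
pn²/(K·C(K,r)) and, by a second moment bound, fluctuations O(n√p), which is o(n²p) because n²p → ∞.
Summing over the C(K,r+1) groups gives (K-r)/(rK). -/

theorem setBernoulli_real_superset {ι : Type*} {u : Set ι} (p : I) (s : Finset ι)
    (hs : (s : Set ι) ⊆ u) :
    (setBernoulli u p).real {t | (s : Set ι) ⊆ t} = (p : ℝ) ^ s.card := by
  have h : (fun q : ι → Prop => {i | q i}) ⁻¹' {t | (s : Set ι) ⊆ t} =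
      Set.pi (s : Set ι) fun _ => {True} := by
    ext q
    simp [Set.subset_def, Set.mem_pi]
  rw [measureReal_def, setBernoulli_apply', h, Measure.infinitePi_pi]
  · rw [Finset.prod_congr rfl (g := fun _ => (toNNReal p : ENNReal))]
    · simp
    · intro i hi
      have : i ∈ u := hs hi
      simp [this]
  · intros; exact MeasurableSet.of_discrete

instance discreteMeasurableSpace_set {ι : Type*} [Finite ι] : DiscreteMeasurableSpace (Set ι) := by
  have : MeasurableSingletonClass (Set ι) := inferInstance
  infer_instance

instance erdosRenyi_isProbabilityMeasure (loops : Prop) (n : ℕ) (p : I) :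
    IsProbabilityMeasure (erdosRenyi loops n p) := by
  unfold erdosRenyi; infer_instance

theorem integrable_erdosRenyi (loops : Prop) (n : ℕ) (p : I) (f : Set (Sym2 (Fin n)) → ℝ) :
    Integrable f (erdosRenyi loops n p) := Integrable.of_finite

open Classical in
/-- The indicator of the event that `e` is an edge. -/
noncomputable def edgeInd {n : ℕ} (e : Sym2 (Fin n)) (E : Set (Sym2 (Fin n))) : ℝ :=
  if e ∈ E then 1 else 0

open Classical in
/-- The probability that `e` is an edge. -/
noncomputable def edgeProb (loops : Prop) {n : ℕ} (p : I) (e : Sym2 (Fin n)) : ℝ :=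
  if e ∈ potentialEdges loops n then (p : ℝ) else 0

theorem edgeProb_le (loops : Prop) {n : ℕ} (p : I) (e : Sym2 (Fin n)) :
    edgeProb loops p e ≤ p := by
  unfold edgeProb; split_ifs
  · exact le_rfl
  · exact p.2.1

theorem edgeProb_nonneg (loops : Prop) {n : ℕ} (p : I) (e : Sym2 (Fin n)) :
    0 ≤ edgeProb loops p e := by
  unfold edgeProb; split_ifs
  · exact p.2.1
  · exact le_rfl

theorem edgeInd_ae_eq_zero (loops : Prop) {n : ℕ} (p : I) {e : Sym2 (Fin n)}
    (he : e ∉ potentialEdges loops n) : ∀ᵐ E ∂erdosRenyi loops n p, edgeInd e E = 0 := by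
  filter_upwards [setBernoulli_ae_subset (u := potentialEdges loops n) (p := p)] with E hE
  simp only [edgeInd, ite_eq_right_iff, one_ne_zero, imp_false]
  exact fun h => he (hE h)

theorem integral_edgeInd (loops : Prop) {n : ℕ} (p : I) (e : Sym2 (Fin n)) :
    ∫ E, edgeInd e E ∂erdosRenyi loops n p = edgeProb loops p e := by
  by_cases he : e ∈ potentialEdges loops n
  · have h := setBernoulli_real_superset p {e} (u := potentialEdges loops n) (by simpa using he)
    have h2 : edgeInd e = Set.indicator {t : Set (Sym2 (Fin n)) | e ∈ t} 1 := by
      ext E; simp [edgeInd, Set.indicator]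
    rw [h2, integral_indicator_one MeasurableSet.of_discrete]
    simpa [edgeProb, he, erdosRenyi] using h
  · rw [integral_congr_ae (edgeInd_ae_eq_zero loops p he)]
    simp [edgeProb, he]

theorem integral_edgeInd_mul (loops : Prop) {n : ℕ} (p : I) {e f : Sym2 (Fin n)} (hef : e ≠ f) :
    ∫ E, edgeInd e E * edgeInd f E ∂erdosRenyi loops n p =
      edgeProb loops p e * edgeProb loops p f := by
  classical
  by_cases he : e ∈ potentialEdges loops n
  · by_cases hf : f ∈ potentialEdges loops n
    · have h := setBernoulli_real_superset p {e, f} (u := potentialEdges loops n)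
        (by simp [Set.insert_subset_iff, he, hf])
      have h2 : (fun E => edgeInd e E * edgeInd f E) =
          Set.indicator {t : Set (Sym2 (Fin n)) | (({e, f} : Finset _) : Set _) ⊆ t} 1 := by
        ext E; simp [edgeInd, Set.indicator, Set.insert_subset_iff, ← ite_and, and_comm]
      rw [h2, integral_indicator_one MeasurableSet.of_discrete]
      rw [Finset.card_pair hef] at h
      simpa [edgeProb, he, hf, erdosRenyi, pow_two] using h
    · rw [integral_congr_ae (g := fun _ => 0)]
      · simp [edgeProb, hf]
      · filter_upwards [edgeInd_ae_eq_zero loops p hf] with E hE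
        simp [hE]
  · rw [integral_congr_ae (g := fun _ => 0)]
    · simp [edgeProb, he]
    · filter_upwards [edgeInd_ae_eq_zero loops p he] with E hE
      simp [hE]

theorem integral_centered_edgeInd_mul_le (loops : Prop) {n : ℕ} (p : I) (e f : Sym2 (Fin n)) :
    ∫ E, (edgeInd e E - edgeProb loops p e) * (edgeInd f E - edgeProb loops p f)
      ∂erdosRenyi loops n p ≤ if e = f then (p : ℝ) else 0 := by
  have h : ∫ E, (edgeInd e E - edgeProb loops p e) * (edgeInd f E - edgeProb loops p f)
      ∂erdosRenyi loops n p = ∫ E, edgeInd e E * edgeInd f E ∂erdosRenyi loops n p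
        - edgeProb loops p e * edgeProb loops p f := by
    have h1 : (fun E => (edgeInd e E - edgeProb loops p e) * (edgeInd f E - edgeProb loops p f)) =
        fun E => edgeInd e E * edgeInd f E + (-edgeProb loops p f * edgeInd e E +
          (-edgeProb loops p e * edgeInd f E + edgeProb loops p e * edgeProb loops p f)) := by
      ext E; ring
    rw [h1, integral_add, integral_add, integral_add, integral_const_mul, integral_const_mul,
      integral_edgeInd, integral_edgeInd]
    · simp; ring
    all_goals exact integrable_erdosRenyi _ _ _ _
  rw [h]
  split_ifs with hef
  · subst hef
    have h2 : (fun E => edgeInd e E * edgeInd e E) = edgeInd e := by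
      ext E; simp [edgeInd]
    rw [h2, integral_edgeInd]
    nlinarith [edgeProb_le loops p e, edgeProb_nonneg loops p e]
  · rw [integral_edgeInd_mul loops p hef]; simp

open Classical in
/-- The number of ordered pairs in `P` whose unordered pair is an edge. -/
noncomputable def pairCount {n : ℕ} (P : Finset (Fin n × Fin n)) (E : Set (Sym2 (Fin n))) : ℕ :=
  (P.filter fun a => s(a.1, a.2) ∈ E).card

theorem pairCount_eq_sum {n : ℕ} (P : Finset (Fin n × Fin n)) (E : Set (Sym2 (Fin n))) :
    (pairCount P E : ℝ) = ∑ a ∈ P, edgeInd s(a.1, a.2) E := by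
  classical
  simp [pairCount, edgeInd]

theorem integral_pairCount (loops : Prop) {n : ℕ} (p : I) (P : Finset (Fin n × Fin n)) :
    ∫ E, (pairCount P E : ℝ) ∂erdosRenyi loops n p = ∑ a ∈ P, edgeProb loops p s(a.1, a.2) := by
  simp_rw [pairCount_eq_sum]
  rw [integral_finsetSum _ fun _ _ => integrable_erdosRenyi _ _ _ _]
  simp_rw [integral_edgeInd]

theorem integral_pairCount_le (loops : Prop) {n : ℕ} (p : I) (P : Finset (Fin n × Fin n)) :
    ∫ E, (pairCount P E : ℝ) ∂erdosRenyi loops n p ≤ p * P.card := by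
  rw [integral_pairCount]
  refine (Finset.sum_le_sum fun a _ => edgeProb_le loops p _).trans ?_
  simp [mul_comm]

/-- Distinct edges are uncorrelated, so only equal unordered pairs contribute. The factor 2 appears
because an ordered pair shares its edge with itself and its reversal. -/
theorem integral_sq_pairCount_sub_le (loops : Prop) {n : ℕ} (p : I)
    (P : Finset (Fin n × Fin n)) :
    ∫ E, ((pairCount P E : ℝ) - ∑ a ∈ P, edgeProb loops p s(a.1, a.2)) ^ 2
      ∂erdosRenyi loops n p ≤ 2 * p * P.card := by
  classical
  simp_rw [pairCount_eq_sum, ← Finset.sum_sub_distrib, pow_two, Finset.sum_mul_sum]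
  rw [integral_finsetSum _ fun _ _ => integrable_erdosRenyi _ _ _ _]
  calc _ ≤ ∑ a ∈ P, 2 * (p : ℝ) := by
        refine Finset.sum_le_sum fun a _ => ?_
        rw [integral_finsetSum _ fun _ _ => integrable_erdosRenyi _ _ _ _]
        refine (Finset.sum_le_sum fun b _ => integral_centered_edgeInd_mul_le loops p _ _).trans ?_
        rw [← Finset.sum_filter, Finset.sum_const, nsmul_eq_mul]
        refine mul_le_mul_of_nonneg_right ?_ p.2.1
        have hsub : P.filter (fun b => s(a.1, a.2) = s(b.1, b.2)) ⊆ {a, a.swap} := by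
          intro b hb
          have := (Finset.mem_filter.1 hb).2
          simp only [Finset.mem_insert, Finset.mem_singleton]
          rcases Sym2.eq_iff.1 this with ⟨h1, h2⟩ | ⟨h1, h2⟩
          · left; ext <;> simp [h1, h2]
          · right; ext <;> simp [h1, h2]
        exact_mod_cast (Finset.card_le_card hsub).trans Finset.card_le_two
    _ = 2 * p * P.card := by simp; ring

/-- Follows from |x| ≤ x²/a + a; the scale `a` is left free, to be set to the order of the standard
deviation. -/
theorem integral_abs_pairCount_sub_le (loops : Prop) {n : ℕ} (p : I)
    (P : Finset (Fin n × Fin n)) {a : ℝ} (ha : 0 < a) :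
    ∫ E, |(pairCount P E : ℝ) - ∑ a ∈ P, edgeProb loops p s(a.1, a.2)|
      ∂erdosRenyi loops n p ≤ 2 * p * P.card / a + a := by
  have h : ∀ x : ℝ, |x| ≤ x ^ 2 / a + a := by
    intro x
    rw [div_add' _ _ _ ha.ne', le_div_iff₀ ha]
    nlinarith [sq_nonneg (|x| - a), sq_abs x, abs_nonneg x]
  calc _ ≤ ∫ E, (((pairCount P E : ℝ) - ∑ a ∈ P, edgeProb loops p s(a.1, a.2)) ^ 2 / a + a)
      ∂erdosRenyi loops n p :=
        integral_mono (integrable_erdosRenyi _ _ _ _) (integrable_erdosRenyi _ _ _ _)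
          fun E => h _
    _ ≤ _ := by
        rw [integral_add (integrable_erdosRenyi _ _ _ _) (integrable_erdosRenyi _ _ _ _),
          integral_div]
        have := integral_sq_pairCount_sub_le loops p P
        simp only [integral_const, probReal_univ, one_smul]
        gcongr

end Probability

/-! ### Communication lower bound by counting message tuples -/

section Converse

set_option linter.unusedSectionVars false

variable {ι V W : Type*} [Fintype ι] [DecidableEq ι] [Fintype V] [DecidableEq V]
  [Fintype W] [DecidableEq W] {C : ι → Type*} [∀ k, DecidableEq (C k)]

/-- The contribution to the communication lower bound of the values that are known only inside
`S` and needed inside `S`: a value known to the machines in `U e` counts `1 / |U e|`. -/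
noncomputable def converseWeight (U : V → Finset ι) (o : V → ι) (S : Finset ι) : ℝ :=
  ∑ e, if U e ⊆ S ∧ o e ∈ S ∧ o e ∉ U e then 1 / ((U e).card : ℝ) else 0

/-- The value indices needed by `k` and known only inside `S` and not to `k`. -/
def demandSet (U : V → Finset ι) (o : V → ι) (S : Finset ι) (k : ι) : Finset V :=
  Finset.univ.filter fun e => U e ⊆ S.erase k ∧ o e = k

/-- Each value e with u = |U e| is counted separately: 1 from k = o e, and 1/u from each of the |S|
- u - 1 members outside U e ∪ {o e}, in total (|S| - 1)/u. This identity is what makes 1/u the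
weight that survives the induction. -/
theorem sum_demandSet_add_converseWeight (U : V → Finset ι) (hU : ∀ e, (U e).Nonempty)
    (o : V → ι) (S : Finset ι) :
    ∑ k ∈ S, (((demandSet U o S k).card : ℝ) + converseWeight U o (S.erase k)) =
      ((S.card : ℝ) - 1) * converseWeight U o S := by
  have hD : ∀ k, ((demandSet U o S k).card : ℝ) =
      ∑ e, if U e ⊆ S.erase k ∧ o e = k then (1 : ℝ) else 0 := by
    intro k; simp [demandSet]
  simp_rw [hD, converseWeight, ← Finset.sum_add_distrib, Finset.mul_sum]
  rw [Finset.sum_comm]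
  refine Finset.sum_congr rfl fun e _ => ?_
  split_ifs with h
  · obtain ⟨h1, h2, h3⟩ := h
    have hUpos : ((U e).card : ℝ) ≠ 0 := by
      exact_mod_cast (Finset.card_pos.2 (hU e)).ne'
    rw [Finset.sum_add_distrib]
    have hfst : ∑ k ∈ S, (if U e ⊆ S.erase k ∧ o e = k then (1 : ℝ) else 0) = 1 := by
      rw [Finset.sum_eq_single (o e)]
      · simp [Finset.subset_erase, h1, h3]
      · intro k _ hk; simp [hk.symm]
      · exact fun h => absurd h2 h
    have hsnd : ∑ k ∈ S, (if U e ⊆ S.erase k ∧ o e ∈ S.erase k ∧ o e ∉ U e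
        then 1 / ((U e).card : ℝ) else 0) =
        ((S \ insert (o e) (U e)).card : ℝ) * (1 / ((U e).card : ℝ)) := by
      rw [← Finset.sum_filter, Finset.sum_const, nsmul_eq_mul]
      congr 3
      ext k
      simp only [Finset.mem_filter, Finset.subset_erase, Finset.mem_erase, Finset.mem_sdiff,
        Finset.mem_insert]
      grind
    rw [hfst, hsnd, Finset.card_sdiff_of_subset (Finset.insert_subset h2 h1),
      Nat.cast_sub (Finset.card_le_card (Finset.insert_subset h2 h1)),
      Finset.card_insert_of_notMem h3]
    push_cast
    field_simp
    ring
  · rw [mul_zero]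
    refine Finset.sum_eq_zero fun k hk => ?_
    rw [if_neg, if_neg, add_zero]
    · rintro ⟨h1, h2, h3⟩
      exact h ⟨h1.trans (Finset.erase_subset _ _), Finset.mem_of_mem_erase h2, h3⟩
    · rintro ⟨h1, rfl⟩
      exact h ⟨h1.trans (Finset.erase_subset _ _), hk, fun h3 => by simpa using h1 h3⟩

/-- The configurations that agree with `v₀` on every value known or needed outside `S`. -/
def agreeing (U : V → Finset ι) (o : V → ι) (S : Finset ι) (v₀ : V → W) : Finset (V → W) :=
  Finset.univ.filter fun v => ∀ e, v e ≠ v₀ e → U e ⊆ S ∧ o e ∈ S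

theorem self_mem_agreeing (U : V → Finset ι) (o : V → ι) (S : Finset ι) (v₀ : V → W) :
    v₀ ∈ agreeing U o S v₀ := by simp [agreeing]

/-- All configurations considered give machine k the same local values as v₁, so k decodes from the
other messages alone. Different choices of the values on `demandSet` therefore produce disjoint sets
of tuples, each of size at least m. -/
theorem card_image_genie_le (U : V → Finset ι) (o : V → ι) (X : ∀ k, (V → W) → C k)
    (hdec : ∀ k v v', (∀ e, k ∈ U e → v e = v' e) → (∀ l, l ≠ k → X l v = X l v') →
      ∀ e, o e = k → v e = v' e)
    {S : Finset ι} {k : ι} (hk : k ∈ S) (v₁ : V → W) {m : ℝ}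
    (hm : ∀ v, m ≤ (((agreeing U o (S.erase k) v).image fun v l => X l v).card : ℝ)) :
    (Fintype.card W : ℝ) ^ (demandSet U o S k).card * m ≤
      (((Finset.univ.filter fun v : V → W => ∀ e, v e ≠ v₁ e → U e ⊆ S.erase k ∧ o e ∈ S).image
        fun v l => X l v).card : ℝ) := by
  set B := (Finset.univ.filter fun v : V → W => ∀ e, v e ≠ v₁ e → U e ⊆ S.erase k ∧ o e ∈ S).image
        fun v l => X l v with hB
  let D := demandSet U o S k
  let ext : (D → W) → V → W := fun z e => if h : e ∈ D then z ⟨e, h⟩ else v₁ e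
  let A : (D → W) → Finset (∀ l, C l) := fun z =>
    (agreeing U o (S.erase k) (ext z)).image fun v l => X l v
  have hmemD : ∀ e, e ∈ D ↔ U e ⊆ S.erase k ∧ o e = k := by
    intro e; simp [D, demandSet]
  have hsub : ∀ z, A z ⊆ B := by
    intro z x hx
    obtain ⟨v, hv, rfl⟩ := Finset.mem_image.1 hx
    refine Finset.mem_image.2 ⟨v, ?_, rfl⟩
    simp only [Finset.mem_filter, Finset.mem_univ, true_and, agreeing] at hv ⊢
    intro e he
    by_cases hD : e ∈ D
    · have := (hmemD e).1 hD
      exact ⟨this.1, this.2 ▸ hk⟩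
    · have := hv e (by simpa [ext, hD] using he)
      exact ⟨this.1, Finset.mem_of_mem_erase this.2⟩
  have hdisj : ∀ z ∈ (Finset.univ : Finset (D → W)), ∀ z' ∈ (Finset.univ : Finset (D → W)),
      z ≠ z' → Disjoint (A z) (A z') := by
    intro z _ z' _ hzz
    rw [Finset.disjoint_left]
    intro x hx hx'
    obtain ⟨v, hv, hvx⟩ := Finset.mem_image.1 hx
    obtain ⟨v', hv', hvx'⟩ := Finset.mem_image.1 hx'
    simp only [Finset.mem_filter, Finset.mem_univ, true_and, agreeing] at hv hv'
    apply hzz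
    have key := hdec k v v' ?_ ?_
    · funext d
      have hd := (hmemD d.1).1 d.2
      have h1 : v d.1 = ext z d.1 := by
        by_contra h
        have := (hv _ h).2
        simp [hd.2] at this
      have h2 : v' d.1 = ext z' d.1 := by
        by_contra h
        have := (hv' _ h).2
        simp [hd.2] at this
      have h3 := key d.1 hd.2
      rw [h1, h2] at h3
      simpa [ext] using h3
    · intro e hke
      have hn : ¬ U e ⊆ S.erase k := fun h => by simpa using h hke
      have hD : e ∉ D := fun h => hn ((hmemD e).1 h).1
      have h1 : v e = ext z e := by
        by_contra h
        exact hn (hv _ h).1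
      have h2 : v' e = ext z' e := by
        by_contra h
        exact hn (hv' _ h).1
      rw [h1, h2]; simp [ext, hD]
    · intro l _
      exact congrFun (hvx.trans hvx'.symm) l
  calc (Fintype.card W : ℝ) ^ D.card * m = ∑ _z : D → W, m := by simp
    _ ≤ ∑ z : D → W, ((A z).card : ℝ) := Finset.sum_le_sum fun z _ => hm _
    _ = ((Finset.univ.biUnion A).card : ℝ) := by
        rw [Finset.card_biUnion hdisj]; push_cast; rfl
    _ ≤ B.card := by
        exact_mod_cast Finset.card_le_card (Finset.biUnion_subset.2 fun z _ => hsub z)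

/-- Let N(S) be the number of tuples and q = |W|. Splitting by the message of k ∈ S gives N(S) ≥ |a
k| · q^|D_k| · N(S \ {k}), with N(S \ {k}) bounded below uniformly in the base configuration. Adding
the logarithms over k and using N(S) ≤ ∏ |a k| leaves (|S| - 1) log N(S) on one side and, by the
counting identity, (|S| - 1) times the weight on the other. -/
theorem converseWeight_mul_log_le (U : V → Finset ι) (hU : ∀ e, (U e).Nonempty) (o : V → ι)
    [Nonempty W] (X : ∀ k, (V → W) → C k)
    (hloc : ∀ k v v', (∀ e, k ∈ U e → v e = v' e) → X k v = X k v')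
    (hdec : ∀ k v v', (∀ e, k ∈ U e → v e = v' e) → (∀ l, l ≠ k → X l v = X l v') →
      ∀ e, o e = k → v e = v' e) (S : Finset ι) (v₀ : V → W) :
    converseWeight U o S * Real.log (Fintype.card W) ≤
      Real.log ((agreeing U o S v₀).image fun v l => X l v).card := by
  induction hs : S.card generalizing S v₀ with
  | zero =>
    have : S = ∅ := Finset.card_eq_zero.1 hs
    subst this
    have h0 : converseWeight U o ∅ = 0 := by simp [converseWeight]
    rw [h0, zero_mul]
    exact Real.log_natCast_nonneg _
  | succ s ih =>
    set A := (agreeing U o S v₀).image fun v l => X l v with hA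
    have hApos : 0 < A.card := Finset.card_pos.2 ⟨_, Finset.mem_image_of_mem _
      (self_mem_agreeing U o S v₀)⟩
    -- The final division is by s = |S| - 1, so singletons are separate: a value known only to the
    -- single member is not missing there, and the weight vanishes.
    rcases Nat.eq_zero_or_pos s with rfl | hspos
    · have h0 : converseWeight U o S = 0 := by
        refine Finset.sum_eq_zero fun e _ => if_neg ?_
        rintro ⟨h1, h2, h3⟩
        obtain ⟨a, ha⟩ := Finset.card_eq_one.1 hs
        obtain ⟨b, hb⟩ := hU e
        have hb' := h1 hb
        rw [ha, Finset.mem_singleton] at hb' h2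
        exact h3 (by rw [h2, ← hb']; exact hb)
      rw [h0, zero_mul]
      exact Real.log_natCast_nonneg _
    let a : ∀ k, Finset (C k) := fun k => (agreeing U o S v₀).image (X k)
    have hapos : ∀ k, 0 < (a k).card := fun k => Finset.card_pos.2 ⟨_, Finset.mem_image_of_mem _
      (self_mem_agreeing U o S v₀)⟩
    have hprod : A.card ≤ ∏ k ∈ S, (a k).card := by
      -- A machine outside S sees only values on which all agreeing configurations coincide, so its
      -- message is constant.
      have hone : ∀ k ∈ (Finset.univ : Finset ι), k ∉ S → (a k).card = 1 := by
        intro k _ hk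
        refine le_antisymm (Finset.card_le_one.2 ?_) (hapos k)
        have hconst : ∀ v ∈ agreeing U o S v₀, X k v = X k v₀ := by
          intro v hv
          refine hloc k v v₀ fun e he => ?_
          by_contra hne
          exact hk (((Finset.mem_filter.1 hv).2 e hne).1 he)
        intro x hx y hy
        obtain ⟨v, hv, rfl⟩ := Finset.mem_image.1 hx
        obtain ⟨w, hw, rfl⟩ := Finset.mem_image.1 hy
        rw [hconst v hv, hconst w hw]
      rw [Finset.prod_subset (Finset.subset_univ S) hone, ← Fintype.card_piFinset]
      refine Finset.card_le_card fun x hx => ?_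
      obtain ⟨v, hv, rfl⟩ := Finset.mem_image.1 hx
      exact Fintype.mem_piFinset.2 fun k => Finset.mem_image_of_mem _ hv
    have hstep : ∀ k ∈ S, Real.log (a k).card + ((demandSet U o S k).card +
        converseWeight U o (S.erase k)) * Real.log (Fintype.card W) ≤ Real.log A.card := by
      intro k hk
      have hqpos : (0 : ℝ) < Fintype.card W := by exact_mod_cast Fintype.card_pos
      set m : ℝ := Real.exp (converseWeight U o (S.erase k) * Real.log (Fintype.card W)) with hmdef
      have hm : ∀ v, m ≤ (((agreeing U o (S.erase k) v).image fun v l => X l v).card : ℝ) := by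
        intro v
        rw [hmdef, ← Real.le_log_iff_exp_le]
        · exact ih (S.erase k) v (by rw [Finset.card_erase_of_mem hk, hs]; rfl)
        · exact_mod_cast Finset.card_pos.2 ⟨_, Finset.mem_image_of_mem _
            (self_mem_agreeing U o (S.erase k) v)⟩
      have hmul : ((a k).card : ℝ) * ((Fintype.card W : ℝ) ^ (demandSet U o S k).card * m) ≤
          A.card := by
        have hmaps : ∀ x ∈ A, x k ∈ a k := by
          intro x hx
          obtain ⟨v, hv, rfl⟩ := Finset.mem_image.1 hx
          exact Finset.mem_image_of_mem _ hv
        rw [Finset.card_eq_sum_card_fiberwise hmaps, Nat.cast_sum, ← nsmul_eq_mul]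
        refine Finset.card_nsmul_le_sum _ _ _ fun c hc => ?_
        obtain ⟨v₁, hv₁, rfl⟩ := Finset.mem_image.1 hc
        -- Altering v₁ only at values unknown to k preserves its message, so these tuples all lie in
        -- the fibre of that message.
        refine (card_image_genie_le U o X hdec hk v₁ hm).trans ?_
        refine Nat.cast_le.2 (Finset.card_le_card fun x hx => ?_)
        obtain ⟨v, hv, rfl⟩ := Finset.mem_image.1 hx
        have hv' := (Finset.mem_filter.1 hv).2
        have hv₁' := (Finset.mem_filter.1 hv₁).2
        refine Finset.mem_filter.2 ⟨Finset.mem_image.2 ⟨v, ?_, rfl⟩, ?_⟩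
        · refine Finset.mem_filter.2 ⟨Finset.mem_univ _, fun e he => ?_⟩
          by_cases h1 : v e = v₁ e
          · exact hv₁' e (h1 ▸ he)
          · exact ⟨(hv' e h1).1.trans (Finset.erase_subset _ _), (hv' e h1).2⟩
        · refine hloc k v v₁ fun e he => ?_
          by_contra hne
          simpa using (hv' e hne).1 he
      have hak : (0 : ℝ) < (a k).card := by exact_mod_cast hapos k
      have hmpos : 0 < m := Real.exp_pos _
      have hlog := Real.log_le_log (by positivity) hmul
      rw [Real.log_mul hak.ne' (by positivity), Real.log_mul (by positivity) hmpos.ne',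
        Real.log_pow, Real.log_exp] at hlog
      linarith
    have hsum := Finset.sum_le_sum hstep
    rw [Finset.sum_add_distrib, ← Finset.sum_mul, sum_demandSet_add_converseWeight U hU,
      Finset.sum_const, nsmul_eq_mul] at hsum
    have hlogprod : Real.log A.card ≤ ∑ k ∈ S, Real.log (a k).card := by
      rw [← Real.log_prod fun k _ => by exact_mod_cast (hapos k).ne']
      exact Real.log_le_log (by exact_mod_cast hApos) (by exact_mod_cast hprod)
    rw [hs] at hsum
    push_cast at hsum
    have hspos' : (0 : ℝ) < s := by exact_mod_cast hspos
    have hfin : (s : ℝ) * (converseWeight U o S * Real.log (Fintype.card W)) ≤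
        s * Real.log A.card := by linarith
    exact le_of_mul_le_mul_left hfin hspos'

end Converse

/-! ### Coded multicast within groups of machines -/

section Scheme

variable {K n : ℕ}

/-- The machines that map vertex `j`. -/
def Allocation.mappers (A : Allocation K n) (j : Fin n) : Finset (Fin K) :=
  Finset.univ.filter fun k => j ∈ A.M k

theorem Allocation.mem_mappers {A : Allocation K n} {j : Fin n} {k : Fin K} :
    k ∈ A.mappers j ↔ j ∈ A.M k := by simp [Allocation.mappers]

/-- The ordered pairs `(i, j)` such that `k` reduces `i` and the machines that map `j` are those
of `S` except `k`. -/
def Allocation.groupPairs (A : Allocation K n) (o : Fin n → Fin K) (S : Finset (Fin K))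
    (k : Fin K) : Finset (Fin n × Fin n) :=
  Finset.univ.filter fun a => o a.1 = k ∧ k ∉ A.mappers a.2 ∧ insert k (A.mappers a.2) = S

theorem card_groupBits (A : Allocation K n) (E : Set (Sym2 (Fin n))) (T : ℕ) (o : Fin n → Fin K)
    (S : Finset (Fin K)) (k : Fin K) :
    Nat.card {b : ValueIdx E × Fin T // b.1.1 ∈ A.groupPairs o S k} =
      T * pairCount (A.groupPairs o S k) E := by
  classical
  have e1 : {b : ValueIdx E × Fin T // b.1.1 ∈ A.groupPairs o S k} ≃
      {a // a ∈ (A.groupPairs o S k).filter fun a => s(a.1, a.2) ∈ E} × Fin T :=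
    { toFun := fun b => (⟨b.1.1.1, Finset.mem_filter.2 ⟨b.2, b.1.1.2⟩⟩, b.1.2)
      invFun := fun b => ⟨(⟨b.1.1, (Finset.mem_filter.1 b.1.2).2⟩, b.2),
        (Finset.mem_filter.1 b.1.2).1⟩
      left_inv := fun b => rfl
      right_inv := fun b => rfl }
  rw [Nat.card_congr e1, Nat.card_prod]
  simp only [Nat.card_eq_fintype_card, Fintype.card_coe, Fintype.card_fin, pairCount]
  rw [mul_comm]

/-- Receiver k's bits in group S inject into the (|S| - 1) · len S slots (sender, position). Only
bits of the same receiver must avoid each other; bits of different receivers share slots, where they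
are added. -/
theorem exists_bit_slots (A : Allocation K n) (E : Set (Sym2 (Fin n))) (T : ℕ)
    (o : Fin n → Fin K) (len : Finset (Fin K) → ℕ)
    (hlen : ∀ S k, T * pairCount (A.groupPairs o S k) E ≤ (S.card - 1) * len S) :
    ∃ (lb : ValueIdx E × Fin T → Fin K) (qb : ValueIdx E × Fin T → ℕ),
      (∀ S k (b : ValueIdx E × Fin T), b.1.1 ∈ A.groupPairs o S k →
        lb b ∈ A.mappers b.1.1.2 ∧ qb b < len S) ∧
      ∀ S k (b b' : ValueIdx E × Fin T), b.1.1 ∈ A.groupPairs o S k →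
        b'.1.1 ∈ A.groupPairs o S k → lb b = lb b' → qb b = qb b' → b = b' := by
  classical
  have hφ : ∀ S k, Nonempty ({b : ValueIdx E × Fin T // b.1.1 ∈ A.groupPairs o S k} ↪
      {l // l ∈ S.erase k} × Fin (len S)) := by
    intro S k
    apply Function.Embedding.nonempty_of_card_le
    rw [← Nat.card_eq_fintype_card, card_groupBits]
    by_cases hk : k ∈ S
    · refine (hlen S k).trans ?_
      rw [Fintype.card_prod, Fintype.card_coe, Finset.card_erase_of_mem hk, Fintype.card_fin]
    · have : A.groupPairs o S k = ∅ := by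
        refine Finset.filter_eq_empty_iff.2 ?_
        rintro a - ⟨-, -, rfl⟩
        exact hk (Finset.mem_insert_self _ _)
      simp [this, pairCount]
  let φ := fun S k => (hφ S k).some
  -- A bit determines its group and receiver, so the embeddings chosen for each (S, k) glue. The
  -- default values occur only at bits in no group, which are never sent.
  let S₀ : ValueIdx E × Fin T → Finset (Fin K) :=
    fun b => insert (o b.1.1.1) (A.mappers b.1.1.2)
  let lb : ValueIdx E × Fin T → Fin K := fun b =>
    if h : b.1.1 ∈ A.groupPairs o (S₀ b) (o b.1.1.1) then (φ _ _ ⟨b, h⟩).1.1 else o b.1.1.1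
  let qb : ValueIdx E × Fin T → ℕ := fun b =>
    if h : b.1.1 ∈ A.groupPairs o (S₀ b) (o b.1.1.1) then (φ _ _ ⟨b, h⟩).2.1 else 0
  have hval : ∀ S k (b : ValueIdx E × Fin T) (h : b.1.1 ∈ A.groupPairs o S k),
      lb b = (φ S k ⟨b, h⟩).1.1 ∧ qb b = (φ S k ⟨b, h⟩).2.1 := by
    intro S k b h
    obtain ⟨rfl, h2, rfl⟩ := (Finset.mem_filter.1 h).2
    exact ⟨dif_pos h, dif_pos h⟩
  refine ⟨lb, qb, ?_, ?_⟩
  · intro S k b h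
    rw [(hval S k b h).1, (hval S k b h).2]
    refine ⟨?_, (φ S k ⟨b, h⟩).2.2⟩
    have h1 := (φ S k ⟨b, h⟩).1.2
    rw [Finset.mem_erase] at h1
    obtain ⟨-, h2, h3⟩ := (Finset.mem_filter.1 h).2
    exact (Finset.mem_insert.1 (h3.symm ▸ h1.2)).resolve_left h1.1
  · intro S k b b' h h' hl hq
    rw [(hval S k b h).1, (hval S k b' h').1] at hl
    rw [(hval S k b h).2, (hval S k b' h').2] at hq
    have := (φ S k).injective (Prod.ext (Subtype.ext hl) (Fin.ext hq))
    exact congrArg Subtype.val this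

open Classical in
/-- Extension by zero of the local values of machine `k`. -/
noncomputable def extendLocal {A : Allocation K n} {E : Set (Sym2 (Fin n))} {T : ℕ} {k : Fin K}
    (x : LocalIdx A E k → Word T) (e : ValueIdx E) : Word T :=
  if h : e.1.2 ∈ A.M k then x ⟨e, h⟩ else 0

theorem extendLocal_restrict {A : Allocation K n} {E : Set (Sym2 (Fin n))} {T : ℕ} {k : Fin K}
    (v : ValueIdx E → Word T) {e : ValueIdx E} (h : e.1.2 ∈ A.M k) :
    extendLocal (fun d : LocalIdx A E k => v d.1) e = v e := by
  simp [extendLocal, h]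

/-- Each slot carries the sum mod 2 of its bits; a receiver subtracts the summands it maps itself
and is left with its own bit. -/
theorem exists_shuffleScheme (A : Allocation K n) (E : Set (Sym2 (Fin n))) (T : ℕ)
    (o : Fin n → Fin K) (ho : ∀ i k, i ∈ A.R k ↔ o i = k) (len : Finset (Fin K) → ℕ)
    (hlen : ∀ S k, T * pairCount (A.groupPairs o S k) E ≤ (S.card - 1) * len S) :
    ∃ sch : ShuffleScheme A E T, ∑ k, sch.c k = ∑ S, S.card * len S := by
  classical
  obtain ⟨lb, qb, hslot, hinj⟩ := exists_bit_slots A E T o len hlen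
  let Key : Fin K → Type := fun l => (S : {S : Finset (Fin K) // l ∈ S}) × Fin (len S)
  let bits : Fin K → Finset (Fin K) → ℕ → Finset (ValueIdx E × Fin T) := fun l S q =>
    Finset.univ.filter fun b => (∃ k, b.1.1 ∈ A.groupPairs o S k) ∧ lb b = l ∧ qb b = q
  let enc : ∀ l, (LocalIdx A E l → Word T) → Key l → ZMod 2 := fun l x q =>
    ∑ b ∈ bits l q.1 q.2, extendLocal x b.1 b.2
  let grp : ValueIdx E → Finset (Fin K) := fun e => insert (o e.1.1) (A.mappers e.1.2)
  have hneed : ∀ k (e : NeededIdx A E k), e.1.1 ∈ A.groupPairs o (grp e.1) k := by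
    intro k e
    have h1 := (ho _ _).1 e.2.1
    refine Finset.mem_filter.2 ⟨Finset.mem_univ _, h1, ?_, ?_⟩
    · rw [Allocation.mem_mappers]; exact e.2.2
    · simp only [grp, h1]
  have hlb : ∀ k (e : NeededIdx A E k) (t : Fin T), lb (e.1, t) ≠ k := by
    intro k e t h
    have := (hslot _ _ (e.1, t) (hneed k e)).1
    rw [h, Allocation.mem_mappers] at this
    exact e.2.2 this
  let key : ∀ k (e : NeededIdx A E k) (t : Fin T), Key (lb (e.1, t)) := fun k e t =>
    ⟨⟨grp e.1, Finset.mem_insert_of_mem (hslot _ _ (e.1, t) (hneed k e)).1⟩,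
      ⟨qb (e.1, t), (hslot _ _ (e.1, t) (hneed k e)).2⟩⟩
  refine ⟨⟨fun l => Fintype.card (Key l),
    fun l x q => enc l x ((Fintype.equivFin (Key l)).symm q),
    fun k x y e t => y ⟨lb (e.1, t), hlb k e t⟩ (Fintype.equivFin _ (key k e t)) -
      ∑ b ∈ (bits (lb (e.1, t)) (grp e.1) (qb (e.1, t))).erase (e.1, t), extendLocal x b.1 b.2,
    ?_⟩, ?_⟩
  · intro v k e
    funext t
    have hmem : (e.1, t) ∈ bits (lb (e.1, t)) (grp e.1) (qb (e.1, t)) :=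
      Finset.mem_filter.2 ⟨Finset.mem_univ _, ⟨k, hneed k e⟩, rfl, rfl⟩
    have hsend : enc (lb (e.1, t)) (fun d => v d.1) (key k e t) =
        ∑ b ∈ bits (lb (e.1, t)) (grp e.1) (qb (e.1, t)), v b.1 b.2 := by
      refine Finset.sum_congr rfl fun b hb => ?_
      obtain ⟨⟨k', hk'⟩, h2, -⟩ := (Finset.mem_filter.1 hb).2
      rw [extendLocal_restrict]
      have := (hslot _ _ b hk').1
      rwa [h2, Allocation.mem_mappers] at this
    have hknown : ∑ b ∈ (bits (lb (e.1, t)) (grp e.1) (qb (e.1, t))).erase (e.1, t),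
        extendLocal (fun d : LocalIdx A E k => v d.1) b.1 b.2 =
        ∑ b ∈ (bits (lb (e.1, t)) (grp e.1) (qb (e.1, t))).erase (e.1, t), v b.1 b.2 := by
      refine Finset.sum_congr rfl fun b hb => ?_
      obtain ⟨hne, hb⟩ := Finset.mem_erase.1 hb
      obtain ⟨⟨k', hk'⟩, h2, h3⟩ := (Finset.mem_filter.1 hb).2
      rw [extendLocal_restrict]
      -- Bits of one receiver occupy distinct slots, so any other summand is meant for some k' ≠ k;
      -- since k lies in the group, it maps that summand.
      have hkk : k ≠ k' := by
        rintro rfl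
        exact hne (hinj _ _ b (e.1, t) hk' (hneed k e) h2 h3)
      have hkS : k ∈ grp e.1 := by
        exact Finset.mem_insert.2 (Or.inl ((ho _ _).1 e.2.1).symm)
      obtain ⟨-, -, h4⟩ := (Finset.mem_filter.1 hk').2
      rw [← h4, Finset.mem_insert, Allocation.mem_mappers] at hkS
      exact hkS.resolve_left hkk
    simp only [Equiv.symm_apply_apply]
    rw [hsend, hknown, ← Finset.add_sum_erase _ _ hmem]
    simp
  · have hcard : ∀ l, Fintype.card (Key l) = ∑ S ∈ Finset.univ.filter (l ∈ ·), len S := by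
      intro l
      simp only [Key, Fintype.card_sigma, Fintype.card_fin]
      exact (Finset.sum_subtype _ (by simp) _).symm
    simp only [hcard]
    rw [Finset.sum_comm' (t' := Finset.univ) (s' := fun S => S) (by simp)]
    simp

end Scheme

/-! ### Lower bound on the average load -/

section LoadBounds

variable {K n : ℕ}

theorem exists_owner {r : ℕ} {A : Allocation K n} (hA : A ∈ allocations K n r) :
    ∃ o : Fin n → Fin K, ∀ i k, i ∈ A.R k ↔ o i = k := by
  obtain ⟨-, -, h3, h4, -⟩ := hA
  choose o ho using h3
  refine ⟨o, fun i k => ⟨fun h => ?_, fun h => h ▸ ho i⟩⟩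
  by_contra hne
  exact Finset.disjoint_left.1 (h4 _ _ hne) (ho i) h

theorem mappers_nonempty {r : ℕ} {A : Allocation K n} (hA : A ∈ allocations K n r) (j : Fin n) :
    (A.mappers j).Nonempty := by
  obtain ⟨k, hk⟩ := hA.1 j
  exact ⟨k, Allocation.mem_mappers.2 hk⟩

theorem two_le_card_of_groupPairs {A : Allocation K n} (hM : ∀ j, (A.mappers j).Nonempty)
    {o : Fin n → Fin K} {S : Finset (Fin K)} {k : Fin K} {a : Fin n × Fin n}
    (ha : a ∈ A.groupPairs o S k) : 2 ≤ S.card := by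
  obtain ⟨-, h2, rfl⟩ := (Finset.mem_filter.1 ha).2
  rw [Finset.card_insert_of_notMem h2]
  have := Finset.card_pos.2 (hM a.2)
  omega

/-- A real infimum over an empty family is 0, so lower bounds on `minLoad` need some scheme; crude
slot lengths suffice. -/
theorem nonempty_shuffleScheme {r : ℕ} {A : Allocation K n} (hA : A ∈ allocations K n r)
    (E : Set (Sym2 (Fin n))) (T : ℕ) : Nonempty (ShuffleScheme A E T) := by
  obtain ⟨o, ho⟩ := exists_owner hA
  obtain ⟨sch, -⟩ := exists_shuffleScheme A E T o ho
    (fun S => ∑ k, T * pairCount (A.groupPairs o S k) E) (by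
      intro S k
      have h1 : T * pairCount (A.groupPairs o S k) E ≤
          ∑ k, T * pairCount (A.groupPairs o S k) E :=
        Finset.single_le_sum (f := fun k => T * pairCount (A.groupPairs o S k) E)
          (fun _ _ => Nat.zero_le _) (Finset.mem_univ k)
      rcases (A.groupPairs o S k).eq_empty_or_nonempty with h | ⟨a, ha⟩
      · simp [h, pairCount]
      · have := two_le_card_of_groupPairs (mappers_nonempty hA) ha
        exact h1.trans (Nat.le_mul_of_pos_left _ (by omega)))
  exact ⟨sch⟩

theorem ShuffleScheme.load_nonneg {A : Allocation K n} {E : Set (Sym2 (Fin n))} {T : ℕ}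
    (sch : ShuffleScheme A E T) : 0 ≤ sch.load := by
  unfold ShuffleScheme.load; positivity

theorem minLoad_nonneg (A : Allocation K n) (T : ℕ) (E : Set (Sym2 (Fin n))) :
    0 ≤ minLoad A T E := Real.iInf_nonneg fun S => S.load_nonneg

theorem minLoad_le {A : Allocation K n} {T : ℕ} {E : Set (Sym2 (Fin n))}
    (sch : ShuffleScheme A E T) : minLoad A T E ≤ sch.load :=
  ciInf_le ⟨0, by rintro _ ⟨S, rfl⟩; exact S.load_nonneg⟩ sch

/-- The weight of the ordered pair `a = (i, j)` in the communication lower bound. -/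
noncomputable def pairWeight (A : Allocation K n) (o : Fin n → Fin K) (a : Fin n × Fin n) : ℝ :=
  if o a.1 ∉ A.mappers a.2 then 1 / ((A.mappers a.2).card : ℝ) else 0

theorem pairWeight_nonneg (A : Allocation K n) (o : Fin n → Fin K) (a : Fin n × Fin n) :
    0 ≤ pairWeight A o a := by
  unfold pairWeight; split_ifs <;> positivity

theorem pairWeight_le_one (A : Allocation K n) (o : Fin n → Fin K) (a : Fin n × Fin n) :
    pairWeight A o a ≤ 1 := by
  unfold pairWeight; split_ifs
  · exact zero_le_one
  · rw [one_div]; exact Nat.cast_inv_le_one _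

/-- The converse for the set of all machines, compared with the at most 2^(∑ c k) possible message
tuples. -/
theorem ShuffleScheme.mul_sum_pairWeight_le {A : Allocation K n} {E : Set (Sym2 (Fin n))} {T : ℕ}
    (sch : ShuffleScheme A E T) (hM : ∀ j, (A.mappers j).Nonempty)
    (o : Fin n → Fin K) (ho : ∀ i k, i ∈ A.R k ↔ o i = k) :
    T * ∑ a, pairWeight A o a * edgeInd s(a.1, a.2) E ≤ ((∑ k, sch.c k : ℕ) : ℝ) := by
  classical
  have hmain := converseWeight_mul_log_le (V := ValueIdx E) (W := Word T)
    (C := fun k => Word (sch.c k)) (fun e => A.mappers e.1.2) (fun e => hM _) (fun e => o e.1.1)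
    (fun k v => sch.encode k fun d => v d.1) ?_ ?_ Finset.univ (fun _ => 0)
  · have hw : converseWeight (fun e : ValueIdx E => A.mappers e.1.2) (fun e => o e.1.1)
        Finset.univ = ∑ a, pairWeight A o a * edgeInd s(a.1, a.2) E := by
      simp only [converseWeight, Finset.subset_univ, Finset.mem_univ, true_and]
      have hterm : ∀ a : Fin n × Fin n, pairWeight A o a * edgeInd s(a.1, a.2) E =
          if s(a.1, a.2) ∈ E then pairWeight A o a else 0 := by
        intro a; simp [edgeInd]
      simp_rw [hterm]
      rw [← Finset.sum_filter (fun a : Fin n × Fin n => s(a.1, a.2) ∈ E)]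
      refine (Finset.sum_subtype (p := fun a : Fin n × Fin n => s(a.1, a.2) ∈ E) _
        (fun a => ?_) (pairWeight A o)).symm
      simp only [Finset.mem_filter, Finset.mem_univ, true_and]
    set N := ((agreeing (fun e : ValueIdx E => A.mappers e.1.2) (fun e => o e.1.1) Finset.univ
      (fun _ => (0 : Word T))).image fun v l => sch.encode l fun d => v d.1).card with hN
    have hNpos : 0 < N := Finset.card_pos.2 ⟨_, Finset.mem_image_of_mem _
      (self_mem_agreeing _ _ _ _)⟩
    have hNle : N ≤ 2 ^ ∑ k, sch.c k := by
      refine (Finset.card_le_univ _).trans_eq ?_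
      simp [Fintype.card_pi, Finset.prod_pow_eq_pow_sum, ZMod.card]
    have hlog : Real.log N ≤ ((∑ k, sch.c k : ℕ) : ℝ) * Real.log 2 := by
      rw [← Real.log_pow]
      exact Real.log_le_log (by exact_mod_cast hNpos) (by exact_mod_cast hNle)
    have hcard : Real.log (Fintype.card (Word T)) = T * Real.log 2 := by
      simp [Word, Fintype.card_pi, ZMod.card]
    rw [hw, hcard] at hmain
    have h2 : 0 < Real.log 2 := Real.log_pos one_lt_two
    refine le_of_mul_le_mul_right (le_trans (le_of_eq ?_) (hmain.trans hlog)) h2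
    ring
  · intro k v v' h
    congr 1
    funext d
    exact h d.1 (Allocation.mem_mappers.2 d.2)
  · intro k v v' hloc hmsg e he
    by_cases hk : e.1.2 ∈ A.M k
    · exact hloc e (Allocation.mem_mappers.2 hk)
    · have h1 := sch.correct v k ⟨e, (ho _ _).2 he, hk⟩
      have h2 := sch.correct v' k ⟨e, (ho _ _).2 he, hk⟩
      rw [← h1, ← h2]
      have hl : (fun d : LocalIdx A E k => v d.1) = fun d => v' d.1 := by
        funext d; exact hloc d.1 (Allocation.mem_mappers.2 d.2)
      have hm : (fun l : {l : Fin K // l ≠ k} =>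
          sch.encode l.1 (fun d => v d.1)) = fun l : {l : Fin K // l ≠ k} => sch.encode l.1 (fun d => v' d.1) := by
        funext l; exact hmsg l.1 l.2
      rw [hl, hm]

theorem sum_pairWeight_ge {r : ℕ} (hr : 1 ≤ r) (hK : 1 ≤ K) {A : Allocation K n}
    (hA : A ∈ allocations K n r) (o : Fin n → Fin K) (ho : ∀ i k, i ∈ A.R k ↔ o i = k) :
    (n : ℝ) ^ 2 * (1 / r - 1 / K) ≤ ∑ a, pairWeight A o a := by
  have hM := mappers_nonempty hA
  obtain ⟨-, hsum, -, -, hR⟩ := hA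
  have hK' : (0 : ℝ) < K := by exact_mod_cast hK
  have hr' : (0 : ℝ) < r := by exact_mod_cast hr
  have hcardR : ∀ k, ((Finset.univ.filter fun i => o i = k).card : ℝ) = n / K := by
    intro k
    have h1 : (Finset.univ.filter fun i => o i = k) = A.R k := by
      ext i; simp [ho]
    rw [h1, eq_div_iff hK'.ne', mul_comm]
    exact_mod_cast hR k
  have hrow : ∀ j, ∑ i, pairWeight A o (i, j) =
      (n : ℝ) / K * (K * (1 / ((A.mappers j).card : ℝ)) - 1) := by
    intro j
    have hpos : ((A.mappers j).card : ℝ) ≠ 0 := by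
      exact_mod_cast (Finset.card_pos.2 (hM j)).ne'
    have h1 : ((Finset.univ.filter fun i => o i ∉ A.mappers j).card : ℝ) =
        ((A.mappers j)ᶜ.card : ℝ) * (n / K) := by
      rw [Finset.card_eq_sum_card_fiberwise (t := (A.mappers j)ᶜ) (f := o)]
      · push_cast
        rw [← nsmul_eq_mul, ← Finset.sum_const]
        refine Finset.sum_congr rfl fun k hk => ?_
        rw [← hcardR k, Finset.filter_filter]
        congr 2
        ext i
        simp only [Finset.mem_filter, Finset.mem_univ, true_and]
        constructor
        · exact fun h => h.2
        · rintro rfl; exact ⟨by simpa using hk, rfl⟩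
      · intro i hi; simpa using hi
    simp only [pairWeight]
    rw [← Finset.sum_filter, Finset.sum_const, nsmul_eq_mul, h1, Finset.card_compl,
      Nat.cast_sub (Finset.card_le_univ _), Fintype.card_fin]
    field_simp
  have hcount : ∑ j, ((A.mappers j).card : ℝ) = r * n := by
    have : ∑ j, (A.mappers j).card = ∑ k, (A.M k).card := by
      simp only [Allocation.mappers, Finset.card_filter]
      rw [Finset.sum_comm]
      refine Finset.sum_congr rfl fun k _ => ?_
      rw [← Finset.card_filter]; simp
    rw [hsum] at this
    exact_mod_cast this
  -- Tangent to 1/x at x = r. After summation only the total ∑ |mappers j| = rn enters, so balance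
  -- of the `M k` is not needed.
  have htangent : ∀ j, 2 / (r : ℝ) - ((A.mappers j).card : ℝ) / r ^ 2 ≤
      1 / ((A.mappers j).card : ℝ) := by
    intro j
    have hpos : (0 : ℝ) < (A.mappers j).card := by
      exact_mod_cast Finset.card_pos.2 (hM j)
    rw [← sub_nonneg]
    have : 1 / ((A.mappers j).card : ℝ) - (2 / (r : ℝ) - ((A.mappers j).card : ℝ) / r ^ 2) =
        ((A.mappers j).card - r : ℝ) ^ 2 / ((A.mappers j).card * r ^ 2) := by
      field_simp; ring
    rw [this]; positivity
  rw [Fintype.sum_prod_type_right]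
  simp_rw [hrow]
  rw [← Finset.mul_sum, Finset.sum_sub_distrib, ← Finset.mul_sum]
  have hinv : (n : ℝ) / r ≤ ∑ j, 1 / ((A.mappers j).card : ℝ) := by
    refine le_trans (le_of_eq ?_) (Finset.sum_le_sum fun j _ => htangent j)
    rw [Finset.sum_sub_distrib, ← Finset.sum_div Finset.univ _ ((r : ℝ) ^ 2), hcount]
    simp
    field_simp
    ring
  have hcalc : (n : ℝ) ^ 2 * (1 / r - 1 / K) = n / K * (K * (n / r) - n) := by
    field_simp
  rw [hcalc]
  simp only [Finset.sum_const, Finset.card_univ, Fintype.card_fin, nsmul_eq_mul, mul_one]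
  gcongr

theorem mul_le_integral_minLoad {r : ℕ} (hr : 1 ≤ r) (hK : 1 ≤ K) (hn : 1 ≤ n) {T : ℕ}
    (hT : 1 ≤ T) (loops : Prop) (p : unitInterval) {A : Allocation K n}
    (hA : A ∈ allocations K n r) :
    (p : ℝ) * (1 / r - 1 / K - 1 / n) ≤ ∫ E, minLoad A T E ∂erdosRenyi loops n p := by
  obtain ⟨o, ho⟩ := exists_owner hA
  have hn' : (0 : ℝ) < n := by exact_mod_cast hn
  have hT' : (0 : ℝ) < T := by exact_mod_cast hT
  have hpt : ∀ E, (∑ a, pairWeight A o a * edgeInd s(a.1, a.2) E) / (n : ℝ) ^ 2 ≤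
      minLoad A T E := by
    intro E
    have := nonempty_shuffleScheme hA E T
    refine le_ciInf fun sch => ?_
    have h := sch.mul_sum_pairWeight_le (mappers_nonempty hA) o ho
    rw [ShuffleScheme.load, div_le_div_iff₀ (by positivity) (by positivity)]
    nlinarith [sq_nonneg (n : ℝ), mul_le_mul_of_nonneg_left h (sq_nonneg (n : ℝ))]
  refine le_trans ?_ (integral_mono (integrable_erdosRenyi _ _ _ _)
    (integrable_erdosRenyi _ _ _ _) hpt)
  rw [integral_div, integral_finsetSum _ fun _ _ => integrable_erdosRenyi _ _ _ _]
  simp_rw [integral_const_mul, integral_edgeInd]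
  -- Off-diagonal pairs are potential edges under either loop convention. A diagonal pair has weight
  -- at most 1, so giving it up costs at most p; this is the source of the 1/n term.
  have hterm : ∀ a : Fin n × Fin n, (p : ℝ) * pairWeight A o a - (if a.1 = a.2 then (p : ℝ) else 0)
      ≤ pairWeight A o a * edgeProb loops p s(a.1, a.2) := by
    intro a
    have hp : (0 : ℝ) ≤ p := p.2.1
    split_ifs with h
    · have h1 := mul_nonneg (pairWeight_nonneg A o a) (edgeProb_nonneg loops p s(a.1, a.2))
      nlinarith [pairWeight_le_one A o a]
    · have : s(a.1, a.2) ∈ potentialEdges loops n := Or.inr (by simpa using h)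
      simp [edgeProb, this, mul_comm]
  have hdiag : ∑ a : Fin n × Fin n, (if a.1 = a.2 then (p : ℝ) else 0) = n * p := by
    rw [Fintype.sum_prod_type]; simp
  have hsum := Finset.sum_le_sum fun a (_ : a ∈ Finset.univ) => hterm a
  rw [Finset.sum_sub_distrib, ← Finset.mul_sum, hdiag] at hsum
  rw [le_div_iff₀ (by positivity)]
  refine le_trans ?_ hsum
  have h3 := mul_le_mul_of_nonneg_left (sum_pairWeight_ge hr hK hA o ho) p.2.1
  have h4 : (p : ℝ) * (1 / r - 1 / K - 1 / n) * (n : ℝ) ^ 2 =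
      p * ((n : ℝ) ^ 2 * (1 / r - 1 / K)) - n * p := by
    field_simp
  rw [h4]
  linarith

end LoadBounds

/-! ### A balanced allocation and its average load -/

section Achievability

variable {K n : ℕ}

/-- The cyclic interval of length `r` starting at `b`. -/
def cyclicInterval (K r : ℕ) [NeZero K] (b : Fin K) : Finset (Fin K) :=
  Finset.univ.filter fun k => (k - b).val < r

theorem card_filter_val_lt {r : ℕ} (hrK : r ≤ K) :
    (Finset.univ.filter fun k : Fin K => k.val < r).card = r := by
  rw [Fin.card_filter_val_lt]; omega

theorem card_cyclicInterval {r : ℕ} (hrK : r ≤ K) [NeZero K] (b : Fin K) :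
    (cyclicInterval K r b).card = r := by
  conv_rhs => rw [← card_filter_val_lt hrK]
  exact Finset.card_equiv (Equiv.subRight b) (by simp [cyclicInterval])

theorem card_filter_mem_cyclicInterval {r : ℕ} (hrK : r ≤ K) [NeZero K] (k : Fin K) :
    (Finset.univ.filter fun b => k ∈ cyclicInterval K r b).card = r := by
  conv_rhs => rw [← card_filter_val_lt hrK]
  exact Finset.card_equiv (Equiv.subLeft k) (by simp [cyclicInterval])

/-- By symmetry under swapping machines the count is independent of k; then incidences are counted
twice. -/
theorem mul_card_powersetCard_filter_mem {r : ℕ} (k : Fin K) :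
    K * ((Finset.powersetCard r (Finset.univ : Finset (Fin K))).filter fun B => k ∈ B).card =
      r * K.choose r := by
  have hsymm : ∀ l : Fin K,
      ((Finset.powersetCard r (Finset.univ : Finset (Fin K))).filter fun B => l ∈ B).card =
      ((Finset.powersetCard r (Finset.univ : Finset (Fin K))).filter fun B => k ∈ B).card := by
    intro l
    refine Finset.card_equiv (Equiv.finsetCongr (Equiv.swap k l)) fun B => ?_
    simp [Finset.mem_map_equiv]
  have hdouble : ∑ l : Fin K,
      ((Finset.powersetCard r (Finset.univ : Finset (Fin K))).filter fun B => l ∈ B).card =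
      r * K.choose r := by
    simp only [Finset.card_filter]
    rw [Finset.sum_comm]
    have : ∀ B ∈ Finset.powersetCard r (Finset.univ : Finset (Fin K)),
        ∑ l : Fin K, (if l ∈ B then 1 else 0) = r := by
      intro B hB
      rw [← (Finset.mem_powersetCard.1 hB).2]
      simp
    rw [Finset.sum_congr rfl this]
    simp [mul_comm]
  rw [← hdouble, Finset.sum_congr rfl fun l _ => hsymm l]
  simp

/-- Assign an `r`-set of machines to each vertex, evenly over the machines and, up to a bounded
error, evenly over the `r`-sets. -/
theorem exists_balanced_assignment {r : ℕ} (hK : 1 ≤ K) (hrK : r ≤ K) (hn : K ∣ n) :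
    ∃ U : Fin n → Finset (Fin K), (∀ j, (U j).card = r) ∧
      (∀ k, K * (Finset.univ.filter fun j => k ∈ U j).card = r * n) ∧
      ∀ B, K.choose r * (Finset.univ.filter fun j => U j = B).card ≤
        n + K * K.choose r ^ 2 := by
  classical
  have : NeZero K := ⟨by omega⟩
  obtain ⟨m, rfl⟩ := hn
  set C := K.choose r with hC
  have hCpos : 0 < C := Nat.choose_pos hrK
  let Sub := {B // B ∈ Finset.powersetCard r (Finset.univ : Finset (Fin K))}
  have hSub : Fintype.card Sub = C := by simp [Sub, hC]
  let q := m / C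
  let t := m % C
  have hmt : C * q + t = m := Nat.div_add_mod m C
  -- With n = Km and m = Cq + t, each r-set receives Kq vertices. The remaining Kt take cyclic
  -- intervals, t per starting point: every machine's load stays exact, and a single r-set gains at
  -- most Kt ≤ KC vertices.
  let X := (Sub × (Fin K × Fin q)) ⊕ (Fin K × Fin t)
  have hX : Fintype.card (Fin (K * m)) = Fintype.card X := by
    simp only [X, Fintype.card_sum, Fintype.card_prod, Fintype.card_fin, hSub]
    rw [← hmt]; ring
  let φ : Fin (K * m) ≃ X := Fintype.equivOfCardEq hX
  let U' : X → Finset (Fin K) := Sum.elim (fun x => x.1.1) fun y => cyclicInterval K r y.1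
  have hcount : ∀ (P : Finset (Fin K) → Prop) [DecidablePred P],
      (Finset.univ.filter fun j => P (U' (φ j))).card =
        (Finset.univ.filter fun B : Sub => P B.1).card * (K * q) +
        (Finset.univ.filter fun b => P (cyclicInterval K r b)).card * t := by
    intro P _
    have h1 : (Finset.univ.filter fun j => P (U' (φ j))).card =
        (Finset.univ.filter fun x => P (U' x)).card :=
      Finset.card_equiv φ (by simp)
    have h2 : (Finset.univ.filter fun x => P (U' x)) =
        ((Finset.univ.filter fun B : Sub => P B.1) ×ˢ
          (Finset.univ : Finset (Fin K × Fin q))).disjSum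
        ((Finset.univ.filter fun b => P (cyclicInterval K r b)) ×ˢ
          (Finset.univ : Finset (Fin t))) := by
      ext x
      rw [Finset.mem_filter]
      rcases x with x | y
      · refine Iff.trans ?_ Finset.inl_mem_disjSum.symm
        simp [U']
      · refine Iff.trans ?_ Finset.inr_mem_disjSum.symm
        simp [U']
    rw [h1, h2, Finset.card_disjSum, Finset.card_product, Finset.card_product]
    simp
  refine ⟨fun j => U' (φ j), ?_, ?_, ?_⟩
  · intro j
    change (U' (φ j)).card = r
    rcases φ j with x | y
    · exact (Finset.mem_powersetCard.1 x.1.2).2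
    · exact card_cyclicInterval hrK _
  · intro k
    change K * (Finset.univ.filter fun j => k ∈ U' (φ j)).card = _
    rw [hcount fun B => k ∈ B, card_filter_mem_cyclicInterval hrK]
    have h2 : (Finset.univ.filter fun B : Sub => k ∈ B.1).card =
        ((Finset.powersetCard r (Finset.univ : Finset (Fin K))).filter fun B => k ∈ B).card := by
      simp only [Finset.card_filter]
      exact Finset.sum_coe_sort _ fun B => if k ∈ B then 1 else 0
    rw [h2]
    have h3 := mul_card_powersetCard_filter_mem (r := r) k
    rw [mul_add, ← mul_assoc, h3, ← hC]
    conv_rhs => rw [← hmt]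
    ring
  · intro B
    change C * (Finset.univ.filter fun j => U' (φ j) = B).card ≤ _
    rw [hcount fun B' => B' = B]
    have h1 : (Finset.univ.filter fun B' : Sub => B'.1 = B).card ≤ 1 := by
      refine Finset.card_le_one.2 fun x hx y hy => Subtype.ext ?_
      rw [(Finset.mem_filter.1 hx).2, (Finset.mem_filter.1 hy).2]
    have h2 : (Finset.univ.filter fun b => cyclicInterval K r b = B).card ≤ K :=
      (Finset.card_le_univ _).trans_eq (Fintype.card_fin K)
    have h3 : t ≤ C := (Nat.mod_lt _ hCpos).le
    calc _ ≤ C * (1 * (K * q) + K * C) := by gcongr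
      _ = K * (C * q) + K * C ^ 2 := by ring
      _ ≤ _ := by gcongr; omega

theorem exists_balancedAllocation {r : ℕ} (hr : 1 ≤ r) (hrK : r ≤ K) (hn : K ∣ n) :
    ∃ A ∈ balancedAllocations K n r, (∀ j, (A.mappers j).card = r) ∧
      ∀ B, K.choose r * (Finset.univ.filter fun j => A.mappers j = B).card ≤
        n + K * K.choose r ^ 2 := by
  classical
  have hK : 0 < K := by omega
  obtain ⟨U, hU1, hU2, hU3⟩ := exists_balanced_assignment hK hrK hn
  obtain ⟨m, rfl⟩ := hn
  let o : Fin (K * m) → Fin K := fun i => (finProdFinEquiv.symm i).1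
  have ho : ∀ k, (Finset.univ.filter fun i => o i = k).card = m := by
    intro k
    have h1 : (Finset.univ.filter fun i => o i = k).card =
        (Finset.univ.filter fun x : Fin K × Fin m => x.1 = k).card :=
      Finset.card_equiv finProdFinEquiv.symm (by simp [o])
    have h2 : (Finset.univ.filter fun x : Fin K × Fin m => x.1 = k) =
        {k} ×ˢ (Finset.univ : Finset (Fin m)) := by
      ext x
      simp only [Finset.mem_filter, Finset.mem_univ, true_and, Finset.mem_product,
        Finset.mem_singleton, and_true]
    rw [h1, h2, Finset.card_product]
    simp
  let A : Allocation K (K * m) :=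
    ⟨fun k => Finset.univ.filter fun j => k ∈ U j, fun k => Finset.univ.filter fun i => o i = k⟩
  have hmap : ∀ j, A.mappers j = U j := by
    intro j; ext k; simp [A, Allocation.mappers]
  refine ⟨A, ⟨⟨?_, ?_, ?_, ?_, ?_⟩, hU2⟩, by simpa only [hmap] using hU1,
    by simpa only [hmap] using hU3⟩
  · intro i
    obtain ⟨k, hk⟩ : (U i).Nonempty := Finset.card_pos.1 (by rw [hU1]; omega)
    exact ⟨k, by simpa [A] using hk⟩
  · refine Nat.eq_of_mul_eq_mul_left hK ?_
    rw [Finset.mul_sum, Finset.sum_congr rfl fun k _ => hU2 k]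
    simp
  · exact fun i => ⟨o i, by simp [A]⟩
  · intro k l hkl
    refine Finset.disjoint_left.2 fun i hi hi' => hkl ?_
    simp only [A, Finset.mem_filter, Finset.mem_univ, true_and] at hi hi'
    rw [← hi, ← hi']
  · intro k
    simp only [A, ho]

theorem card_groupPairs_le {r : ℕ} {A : Allocation K n} (hA : A ∈ allocations K n r)
    {o : Fin n → Fin K} (ho : ∀ i k, i ∈ A.R k ↔ o i = k) (S : Finset (Fin K)) (k : Fin K) :
    K * (A.groupPairs o S k).card ≤
      n * (Finset.univ.filter fun j => A.mappers j = S.erase k).card := by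
  have hsub : A.groupPairs o S k ⊆
      A.R k ×ˢ (Finset.univ.filter fun j => A.mappers j = S.erase k) := by
    intro a ha
    obtain ⟨h1, h2, h3⟩ := (Finset.mem_filter.1 ha).2
    refine Finset.mem_product.2 ⟨(ho _ _).2 h1, Finset.mem_filter.2 ⟨Finset.mem_univ _, ?_⟩⟩
    rw [← h3, Finset.erase_insert h2]
  refine (Nat.mul_le_mul_left K (Finset.card_le_card hsub)).trans_eq ?_
  rw [Finset.card_product, ← mul_assoc, hA.2.2.2.2 k]

/-- Only groups of size r + 1 are nonempty. Their slots must hold the largest demand divided by r,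
rounded up; the `+ 1` is this rounding, since T ≥ 1. -/
theorem minLoad_le_sum_sup {r : ℕ} (hr : 1 ≤ r) (hn : 1 ≤ n) {T : ℕ} (hT : 1 ≤ T)
    {A : Allocation K n} (hAr : ∀ j, (A.mappers j).card = r)
    {o : Fin n → Fin K} (ho : ∀ i k, i ∈ A.R k ↔ o i = k) (E : Set (Sym2 (Fin n))) :
    minLoad A T E ≤ (r + 1) / (n : ℝ) ^ 2 *
      ∑ S ∈ Finset.powersetCard (r + 1) (Finset.univ : Finset (Fin K)),
        (((Finset.univ.sup fun k => pairCount (A.groupPairs o S k) E : ℕ) : ℝ) / r + 1) := by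
  classical
  set G : Finset (Fin K) → ℕ := fun S =>
    Finset.univ.sup fun k => pairCount (A.groupPairs o S k) E with hG
  obtain ⟨sch, hsch⟩ := exists_shuffleScheme A E T o ho
    (fun S => if S.card = r + 1 then T * G S / r + 1 else 0) (by
      intro S k
      have hGk : pairCount (A.groupPairs o S k) E ≤ G S :=
        Finset.le_sup (f := fun k => pairCount (A.groupPairs o S k) E) (Finset.mem_univ k)
      split_ifs with hS
      · rw [hS, Nat.add_sub_cancel]
        exact (Nat.mul_le_mul_left T hGk).trans (Nat.lt_mul_div_succ _ hr).le
      · have : A.groupPairs o S k = ∅ := by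
          refine Finset.filter_eq_empty_iff.2 ?_
          rintro a - ⟨-, h2, rfl⟩
          exact hS (by rw [Finset.card_insert_of_notMem h2, hAr])
        simp [this, pairCount])
  refine (minLoad_le sch).trans ?_
  have hn' : (0 : ℝ) < n := by exact_mod_cast hn
  have hT' : (1 : ℝ) ≤ T := by exact_mod_cast hT
  have hr' : (0 : ℝ) < r := by exact_mod_cast hr
  have hsum : ((∑ k, sch.c k : ℕ) : ℝ) ≤
      T * ((r + 1) * ∑ S ∈ Finset.powersetCard (r + 1) (Finset.univ : Finset (Fin K)),
        ((G S : ℝ) / r + 1)) := by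
    rw [hsch]
    have h1 : ∑ S : Finset (Fin K), S.card * (if S.card = r + 1 then T * G S / r + 1 else 0) =
        ∑ S ∈ Finset.powersetCard (r + 1) (Finset.univ : Finset (Fin K)),
          (r + 1) * (T * G S / r + 1) := by
      have hps : Finset.powersetCard (r + 1) (Finset.univ : Finset (Fin K)) =
          Finset.univ.filter fun S => S.card = r + 1 := by
        ext S; simp [Finset.mem_powersetCard]
      rw [hps, Finset.sum_filter]
      refine Finset.sum_congr rfl fun S _ => ?_
      split_ifs with hS
      · rw [hS]
      · simp
    rw [h1, Nat.cast_sum, Finset.mul_sum, Finset.mul_sum]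
    refine Finset.sum_le_sum fun S _ => ?_
    push_cast
    have h2 : ((T * G S / r : ℕ) : ℝ) ≤ T * G S / r := by
      exact_mod_cast Nat.cast_div_le (α := ℝ) (m := T * G S) (n := r)
    have h3 : (T : ℝ) * ((r + 1) * (G S / r + 1)) = (r + 1) * (T * G S / r + T) := by
      field_simp
    rw [h3]
    gcongr
  rw [ShuffleScheme.load, div_le_iff₀ (by positivity)]
  refine hsum.trans_eq ?_
  field_simp
  rfl

theorem integral_minLoad_le {r : ℕ} (hr : 1 ≤ r) (hrK : r ≤ K) (hn : 1 ≤ n) {T : ℕ} (hT : 1 ≤ T)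
    (loops : Prop) {p : unitInterval} (hp : 0 < p) {A : Allocation K n}
    (hA : A ∈ allocations K n r) (hAr : ∀ j, (A.mappers j).card = r)
    (hAB : ∀ B, K.choose r * (Finset.univ.filter fun j => A.mappers j = B).card ≤
        n + K * K.choose r ^ 2) :
    ∫ E, minLoad A T E ∂erdosRenyi loops n p ≤
      (r + 1) / (n : ℝ) ^ 2 * (K.choose (r + 1) *
        ((p * (n / K * (n / K.choose r + K * K.choose r)) + K * (3 * (n * √p))) / r + 1)) := by
  obtain ⟨o, ho⟩ := exists_owner hA
  have hK' : (0 : ℝ) < K := by exact_mod_cast (by omega : 0 < K)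
  have hn' : (0 : ℝ) < n := by exact_mod_cast hn
  have hp' : (0 : ℝ) < p := hp
  have hC : (0 : ℝ) < K.choose r := by exact_mod_cast Nat.choose_pos hrK
  have hP : ∀ S k, ((A.groupPairs o S k).card : ℝ) ≤
      n / K * (n / K.choose r + K * K.choose r) := by
    intro S k
    have h1 : (K : ℝ) * (A.groupPairs o S k).card ≤
        n * (Finset.univ.filter fun j => A.mappers j = S.erase k).card := by
      exact_mod_cast card_groupPairs_le hA ho S k
    have h2 : (K.choose r : ℝ) * (Finset.univ.filter fun j => A.mappers j = S.erase k).card ≤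
        n + K * K.choose r ^ 2 := by exact_mod_cast hAB (S.erase k)
    have h3 : ((Finset.univ.filter fun j => A.mappers j = S.erase k).card : ℝ) ≤
        n / K.choose r + K * K.choose r := by
      rw [div_add' _ _ _ hC.ne', le_div_iff₀ hC]
      linarith
    rw [div_mul_eq_mul_div, le_div_iff₀ hK', mul_comm]
    exact h1.trans (by gcongr)
  have hPn : ∀ S k, ((A.groupPairs o S k).card : ℝ) ≤ (n : ℝ) ^ 2 := by
    intro S k
    have := Finset.card_le_univ (A.groupPairs o S k)
    rw [Fintype.card_prod, Fintype.card_fin, ← pow_two] at this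
    exact_mod_cast this
  set μ : ℝ := p * (n / K * (n / K.choose r + K * K.choose r)) with hμ
  have hμ0 : 0 ≤ μ := by positivity
  -- The largest demand exceeds the common bound μ on the means by at most the sum of all K
  -- deviations.
  have hsup : ∀ S E, ((Finset.univ.sup fun k => pairCount (A.groupPairs o S k) E : ℕ) : ℝ) ≤
      μ + ∑ k, |(pairCount (A.groupPairs o S k) E : ℝ) -
        ∑ a ∈ A.groupPairs o S k, edgeProb loops p s(a.1, a.2)| := by
    intro S E
    have hne : (Finset.univ : Finset (Fin K)).Nonempty := ⟨⟨0, by omega⟩, Finset.mem_univ _⟩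
    obtain ⟨k, -, hk⟩ := Finset.exists_mem_eq_sup _ hne
      fun k => pairCount (A.groupPairs o S k) E
    rw [hk]
    have h1 := Finset.single_le_sum (f := fun k => |(pairCount (A.groupPairs o S k) E : ℝ) -
        ∑ a ∈ A.groupPairs o S k, edgeProb loops p s(a.1, a.2)|)
        (fun _ _ => abs_nonneg _) (Finset.mem_univ k)
    have h2 : ∑ a ∈ A.groupPairs o S k, edgeProb loops p s(a.1, a.2) ≤ μ := by
      rw [← integral_pairCount]
      exact (integral_pairCount_le loops p _).trans (by rw [hμ]; gcongr; exact hP S k)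
    have h3 := le_abs_self ((pairCount (A.groupPairs o S k) E : ℝ) -
        ∑ a ∈ A.groupPairs o S k, edgeProb loops p s(a.1, a.2))
    linarith
  have hint : ∀ S, ∫ E, ((Finset.univ.sup fun k => pairCount (A.groupPairs o S k) E : ℕ) : ℝ)
      ∂erdosRenyi loops n p ≤ μ + K * (3 * (n * √p)) := by
    intro S
    refine (integral_mono (integrable_erdosRenyi _ _ _ _) (integrable_erdosRenyi _ _ _ _)
      (hsup S)).trans ?_
    rw [integral_add (integrable_erdosRenyi _ _ _ _) (integrable_erdosRenyi _ _ _ _),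
      integral_finsetSum _ fun _ _ => integrable_erdosRenyi _ _ _ _]
    simp only [integral_const, probReal_univ, one_smul]
    -- The scale a = n√p balances 2pn²/a against a, giving the constant 3.
    have ha : 0 < (n : ℝ) * √p := by positivity
    have hdev : ∀ k ∈ (Finset.univ : Finset (Fin K)),
        ∫ E, |(pairCount (A.groupPairs o S k) E : ℝ) -
        ∑ a ∈ A.groupPairs o S k, edgeProb loops p s(a.1, a.2)| ∂erdosRenyi loops n p ≤
        3 * (n * √p) := by
      intro k _
      refine (integral_abs_pairCount_sub_le loops p _ ha).trans ?_
      have h1 : 2 * (p : ℝ) * (A.groupPairs o S k).card / (n * √p) ≤ 2 * (n * √p) := by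
        rw [div_le_iff₀ ha]
        have h2 : 2 * ((n : ℝ) * √p) * (n * √p) = 2 * p * (n : ℝ) ^ 2 := by
          have := Real.mul_self_sqrt hp'.le
          calc _ = 2 * (n : ℝ) ^ 2 * (√p * √p) := by ring
            _ = _ := by rw [this]; ring
        rw [h2]
        gcongr
        exact hPn S k
      linarith
    have := Finset.sum_le_sum hdev
    simp only [Finset.sum_const, Finset.card_univ, Fintype.card_fin, nsmul_eq_mul] at this
    linarith
  refine (integral_mono (integrable_erdosRenyi _ _ _ _) (integrable_erdosRenyi _ _ _ _)
    (minLoad_le_sum_sup hr hn hT hAr ho)).trans ?_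
  rw [integral_const_mul, integral_finsetSum _ fun _ _ => integrable_erdosRenyi _ _ _ _]
  refine mul_le_mul_of_nonneg_left ?_ (by positivity)
  have hcard : (K.choose (r + 1) : ℝ) =
      (Finset.powersetCard (r + 1) (Finset.univ : Finset (Fin K))).card := by simp
  rw [hcard, ← nsmul_eq_mul, ← Finset.sum_const]
  refine Finset.sum_le_sum fun S _ => ?_
  rw [integral_add (integrable_erdosRenyi _ _ _ _) (integrable_erdosRenyi _ _ _ _),
    integral_div]
  simp only [integral_const, probReal_univ, one_smul]
  have := hint S
  gcongr

end Achievability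

/-! ### Squeezing the normalized load -/

section Limit

theorem minAvgLoad_le {K n : ℕ} {𝒜 : Set (Allocation K n)} (T : ℕ) (loops : Prop)
    (p : unitInterval) {A : Allocation K n} (hA : A ∈ 𝒜) :
    minAvgLoad 𝒜 T loops p ≤ ∫ E, minLoad A T E ∂erdosRenyi loops n p :=
  ciInf_le (f := fun A : 𝒜 => ∫ E, minLoad A.1 T E ∂erdosRenyi loops n p)
    ⟨0, by rintro _ ⟨A, rfl⟩; exact integral_nonneg fun E => minLoad_nonneg _ _ _⟩ ⟨A, hA⟩

theorem le_minAvgLoad_div {K n r : ℕ} (hr : 1 ≤ r) (hrK : r ≤ K) (hKn : K ∣ n) (hn : 1 ≤ n)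
    {T : ℕ} (hT : 1 ≤ T) (loops : Prop) {p : unitInterval} (hp : 0 < p)
    {𝒜 : Set (Allocation K n)} (h₁ : balancedAllocations K n r ⊆ 𝒜)
    (h₂ : 𝒜 ⊆ allocations K n r) :
    1 / (r : ℝ) - 1 / K - 1 / n ≤ minAvgLoad 𝒜 T loops p / p := by
  have hp' : (0 : ℝ) < p := hp
  -- Used only to see that the infimum is over a nonempty family.
  obtain ⟨A, hA, -⟩ := exists_balancedAllocation hr hrK hKn
  have : Nonempty 𝒜 := ⟨⟨A, h₁ hA⟩⟩
  rw [le_div_iff₀ hp', mul_comm]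
  exact le_ciInf fun B =>
    mul_le_integral_minLoad hr (hr.trans hrK) hn hT loops p (h₂ B.2)

theorem minAvgLoad_div_le {K n r : ℕ} (hr : 1 ≤ r) (hrK : r ≤ K) (hKn : K ∣ n) (hn : 1 ≤ n)
    {T : ℕ} (hT : 1 ≤ T) (loops : Prop) {p : unitInterval} (hp : 0 < p)
    {𝒜 : Set (Allocation K n)} (h₁ : balancedAllocations K n r ⊆ 𝒜) :
    minAvgLoad 𝒜 T loops p / p ≤ 1 / (r : ℝ) - 1 / K +
      (r + 1) * K.choose (r + 1) * (K.choose r / r * (1 / n) +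
        3 * K / r * √(1 / (n : ℝ) ^ 2 / p) + 1 / (n : ℝ) ^ 2 / p) := by
  have hp' : (0 : ℝ) < p := hp
  have hn' : (0 : ℝ) < n := by exact_mod_cast hn
  have hr' : (0 : ℝ) < r := by exact_mod_cast hr
  have hK' : (0 : ℝ) < K := by exact_mod_cast hr.trans hrK
  have hC : (0 : ℝ) < K.choose r := by exact_mod_cast Nat.choose_pos hrK
  obtain ⟨A, hA, hAr, hAB⟩ := exists_balancedAllocation hr hrK hKn
  have h := (minAvgLoad_le T loops p (h₁ hA)).trans
    (integral_minLoad_le hr hrK hn hT loops hp hA.1 hAr hAB)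
  rw [div_le_iff₀ hp']
  refine h.trans_eq ?_
  -- This identity turns the leading term, the number of groups times the cost of one, into 1/r -
  -- 1/K.
  have hchoose : (K.choose (r + 1) : ℝ) * (r + 1) = K.choose r * (K - r) := by
    have := Nat.choose_succ_right_eq K r
    rw [← Nat.cast_sub hrK]
    exact_mod_cast this
  have hmain : 1 / (r : ℝ) - 1 / K = (r + 1) * K.choose (r + 1) * (1 / (r * K * K.choose r)) := by
    rw [mul_comm ((r : ℝ) + 1), hchoose]
    field_simp
  have hs : √(p : ℝ) * √p = p := Real.mul_self_sqrt hp'.le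
  have hspos : 0 < √(p : ℝ) := Real.sqrt_pos.2 hp'
  have hsqrt : √(1 / (n : ℝ) ^ 2 / p) = 1 / (n * √p) := by
    rw [Real.sqrt_div (by positivity), Real.sqrt_div zero_le_one, Real.sqrt_sq hn'.le,
      Real.sqrt_one, div_div]
  rw [hmain, hsqrt]
  have hps : 1 / ((n : ℝ) * √p) * p = √p / n := by
    rw [div_mul_eq_mul_div, one_mul, div_eq_div_iff (by positivity) (by positivity)]
    nlinarith [hs]
  have hexp : ∀ a b c d e : ℝ, a * (b + (c + d * (1 / ((n : ℝ) * √p)) + e)) * p =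
      a * (b * p + (c * p + d * (1 / ((n : ℝ) * √p) * p) + e * p)) := by intros; ring
  rw [← mul_add, hexp, hps]
  field_simp
  ring

/-- The lower bound holds for every allocation of load r and the upper one is reached by a balanced
allocation, so any family in between has the same limit; this covers both forms of the load
condition. -/
theorem tendsto_minAvgLoad_div {K r : ℕ} (hr : 1 ≤ r) (hrK : r ≤ K)
    {T : ℕ → ℕ} (hT : ∀ n, 1 ≤ T n) (loops : Prop)
    {p : ℕ → unitInterval} (hp_pos : ∀ n, 0 < p n)
    (hp : (fun n : ℕ => 1 / (n : ℝ) ^ 2) =o[atTop ⊓ 𝓟 {n : ℕ | K ∣ n}]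
      (fun n : ℕ => (p n : ℝ)))
    (𝒜 : ∀ n, Set (Allocation K n)) (h₁ : ∀ n, balancedAllocations K n r ⊆ 𝒜 n)
    (h₂ : ∀ n, 𝒜 n ⊆ allocations K n r) :
    Tendsto (fun n : ℕ => minAvgLoad (𝒜 n) (T n) loops (p n) / (p n : ℝ))
      (atTop ⊓ 𝓟 {n : ℕ | K ∣ n}) (𝓝 (1 / (r : ℝ) * (1 - (r : ℝ) / (K : ℝ)))) := by
  have hr' : (r : ℝ) ≠ 0 := by exact_mod_cast (by omega : r ≠ 0)
  have hlim : 1 / (r : ℝ) * (1 - (r : ℝ) / (K : ℝ)) = 1 / r - 1 / K := by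
    rw [mul_sub, mul_one, one_div_mul_eq_div, div_div, mul_comm (K : ℝ), ← div_div, div_self hr']
  rw [hlim]
  have hinv : Tendsto (fun n : ℕ => 1 / (n : ℝ)) (atTop ⊓ 𝓟 {n : ℕ | K ∣ n}) (𝓝 0) :=
    tendsto_one_div_atTop_nhds_zero_nat.mono_left inf_le_left
  have hdens : Tendsto (fun n : ℕ => 1 / (n : ℝ) ^ 2 / p n) (atTop ⊓ 𝓟 {n : ℕ | K ∣ n}) (𝓝 0) :=
    hp.tendsto_div_nhds_zero
  have hsqrt : Tendsto (fun n : ℕ => √(1 / (n : ℝ) ^ 2 / p n)) (atTop ⊓ 𝓟 {n : ℕ | K ∣ n})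
      (𝓝 0) := by
    simpa using hdens.sqrt
  have hev : ∀ᶠ n in atTop ⊓ 𝓟 {n : ℕ | K ∣ n}, K ∣ n ∧ 1 ≤ n :=
    ((eventually_principal.2 fun _ h => h).filter_mono inf_le_right).and
      ((eventually_ge_atTop 1).filter_mono inf_le_left)
  refine tendsto_of_tendsto_of_tendsto_of_le_of_le'
    (g := fun n : ℕ => 1 / (r : ℝ) - 1 / K - 1 / n)
    (h := fun n : ℕ => 1 / (r : ℝ) - 1 / K +
      (r + 1) * K.choose (r + 1) * (K.choose r / r * (1 / n) +
        3 * K / r * √(1 / (n : ℝ) ^ 2 / p n) + 1 / (n : ℝ) ^ 2 / p n)) ?_ ?_ ?_ ?_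
  · simpa using tendsto_const_nhds.sub hinv
  · have := (((hinv.const_mul ((K.choose r : ℝ) / r)).add
      (hsqrt.const_mul (3 * (K : ℝ) / r))).add hdens).const_mul
        (((r : ℝ) + 1) * K.choose (r + 1))
    simpa using this.const_add (1 / (r : ℝ) - 1 / K)
  · filter_upwards [hev] with n hn
    exact le_minAvgLoad_div hr hrK hn.1 hn.2 (hT n) loops (hp_pos n) (h₁ n) (h₂ n)
  · filter_upwards [hev] with n hn
    exact minAvgLoad_div_le hr hrK hn.1 hn.2 (hT n) loops (hp_pos n) (h₁ n)

end Limit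

theorem theorem1 (K r : ℕ) (hr : 1 ≤ r) (hrK : r ≤ K)
    (T : ℕ → ℕ) (hT : ∀ n, 1 ≤ T n)
    (loops : Prop)
    (p : ℕ → unitInterval) (hp_pos : ∀ n, 0 < p n)
    (hp : (fun n : ℕ => 1 / (n : ℝ) ^ 2) =o[atTop ⊓ 𝓟 {n : ℕ | K ∣ n}]
      (fun n : ℕ => (p n : ℝ))) :
    Tendsto (fun n : ℕ =>
        minAvgLoad (balancedAllocations K n r) (T n) loops (p n) / (p n : ℝ))
      (atTop ⊓ 𝓟 {n : ℕ | K ∣ n})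
      (𝓝 (1 / (r : ℝ) * (1 - (r : ℝ) / (K : ℝ)))) ∧
    Tendsto (fun n : ℕ =>
        minAvgLoad (allocations K n r) (T n) loops (p n) / (p n : ℝ))
      (atTop ⊓ 𝓟 {n : ℕ | K ∣ n})
      (𝓝 (1 / (r : ℝ) * (1 - (r : ℝ) / (K : ℝ)))) := by
  exact ⟨tendsto_minAvgLoad_div hr hrK hT loops hp_pos hp _ (fun _ => subset_rfl) fun _ _ h => h.1,
    tendsto_minAvgLoad_div hr hrK hT loops hp_pos hp _ (fun _ _ h => h.1) fun _ => subset_rfl⟩
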